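/- Let $X$ and $Y$ be complex Banach spaces, and let $S\in L(X)$ and $T\in L(Y)$ be bounded linear operators. For a bounded linear operator $A$ on a complex Banach space $Z$ let $\alpha(A)\in\mathbb N\cup\{\infty\}$ be the dimension of its kernel, $\beta(A)\in\mathbb N\cup\{\infty\}$ the codimension of its range, and let $\sigma(A)$ be its spectrum. The operator $A$ is called upper semi-Fredholm if its range is closed and $\alpha(A)<\infty$; its index is then $\operatorname{ind}A=\alpha(A)-\beta(A)\in\mathbb Z\cup\{-\infty\}$. It is called upper semi-Weyl if it is upper semi-Fredholm with $\operatorname{ind}A\le 0$. Put $$\sigma_{uw}(A)=\{\lambda\in\mathbb C: A-\lambda I\text{ is not upper semi-Weyl}\},$$ $$\sigma_a(A)=\{\lambda\in\mathbb C: \text{there is no } c>0 \text{ with } \|(A-\lambda I)x\|\ge c\|x\| \text{ for all } x\in Z\}$$ (the approximate spectrum), and let $\pi_{00}^a(A)$ be the set of isolated points $\lambda$ of $\sigma_a(A)$ that are eigenvalues of $A$ of finite multiplicity, i.e. $0<\alpha(A-\lambda I)<\infty$. The operator $A$ has property $(z)$ if $\sigma(A)\setminus\sigma_{uw}(A)=\pi_{00}^a(A)$,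 and $A$ is a-isoloid if every isolated point of $\sigma_a(A)$ is an eigenvalue of $A$. Suppose that $S$ and $T$ both have property $(z)$ and are both a-isoloid. Then the direct sum $S\oplus T$ on $X\oplus Y$ has property $(z)$ if and only if $$\sigma_{uw}(S\oplus T)=\sigma_{uw}(S)\cup\sigma_{uw}(T).$$ -/

import Mathlib

noncomputable section

namespace PropertyZ

variable {X : Type*} [NormedAddCommGroup X] [NormedSpace ℂ X]

/-- The nullity `α(T)`: the dimension of the kernel of `T`, in `ℕ ∪ {∞}`. -/
def nullity (T : X →L[ℂ] X) : ℕ∞ :=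
  Cardinal.toENat (Module.rank ℂ (LinearMap.ker (T : X →ₗ[ℂ] X)))

/-- The deficiency `β(T)`: the codimension of the range of `T`, in `ℕ ∪ {∞}`. -/
def deficiency (T : X →L[ℂ] X) : ℕ∞ :=
  Cardinal.toENat (Module.rank ℂ (X ⧸ LinearMap.range (T : X →ₗ[ℂ] X)))

/-- `T` is upper semi-Fredholm: its range is closed and its kernel is finite-dimensional. -/
def IsUpperSemiFredholm (T : X →L[ℂ] X) : Prop :=
  IsClosed (Set.range T) ∧ nullity T < ⊤

/-- The index `ind T = α(T) - β(T)`, with values in the extended reals (the only ill-defined case,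
`∞ - ∞`, does not occur for semi-Fredholm operators; for upper semi-Fredholm operators `α(T)` is
finite, and the index is an integer or `-∞`). -/
def index (T : X →L[ℂ] X) : EReal :=
  ((nullity T : ENNReal) : EReal) - ((deficiency T : ENNReal) : EReal)

/-- `T` is upper semi-Weyl: upper semi-Fredholm of index at most `0`. -/
def IsUpperSemiWeyl (T : X →L[ℂ] X) : Prop :=
  IsUpperSemiFredholm T ∧ index T ≤ 0

/-- The upper semi-Weyl spectrum `σ_uw(T)`. -/
def upperSemiWeylSpectrum (T : X →L[ℂ] X) : Set ℂ :=
  {z | ¬ IsUpperSemiWeyl (T - z • (1 : X →L[ℂ] X))}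

/-- `T` is bounded below (equivalently, no sequence of unit vectors is mapped to a null
sequence). -/
def IsBoundedBelow (T : X →L[ℂ] X) : Prop :=
  ∃ c : ℝ, 0 < c ∧ ∀ x : X, c * ‖x‖ ≤ ‖T x‖

/-- The approximate (point) spectrum `σ_a(T)`. -/
def approxSpectrum (T : X →L[ℂ] X) : Set ℂ :=
  {z | ¬ IsBoundedBelow (T - z • (1 : X →L[ℂ] X))}

/-- The point spectrum `σ_p(T)`: the eigenvalues of `T`. -/
def pointSpectrum (T : X →L[ℂ] X) : Set ℂ :=
  {z | Module.End.HasEigenvalue (T : X →ₗ[ℂ] X) z}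

/-- `σ_p⁰(T)`: the eigenvalues of `T` of finite multiplicity, that is, with finite-dimensional
eigenspace. -/
def finitePointSpectrum (T : X →L[ℂ] X) : Set ℂ :=
  {z | z ∈ pointSpectrum T ∧ nullity (T - z • (1 : X →L[ℂ] X)) < ⊤}

/-- The isolated points of a set of complex numbers: its points that are not accumulation points
of it. -/
def iso (A : Set ℂ) : Set ℂ := A \ derivedSet A

/-- `π₀₀ᵃ(T)`: the isolated points of the approximate spectrum that are eigenvalues of finite
multiplicity. -/
def piA00 (T : X →L[ℂ] X) : Set ℂ :=
  iso (approxSpectrum T) ∩ finitePointSpectrum T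

/-- Property `(z)`. -/
def HasPropertyZ (T : X →L[ℂ] X) : Prop :=
  spectrum ℂ T \ upperSemiWeylSpectrum T = piA00 T

/-- `T` is a-isoloid: every isolated point of the approximate spectrum is an eigenvalue. -/
def IsAIsoloid (T : X →L[ℂ] X) : Prop :=
  iso (approxSpectrum T) ⊆ pointSpectrum T

end PropertyZ

end

namespace PropertyZ

section DirectSum

variable {X Y : Type*} [NormedAddCommGroup X] [NormedSpace ℂ X]
  [NormedAddCommGroup Y] [NormedSpace ℂ Y]

/-! Nullity adds over a direct sum, and `σ`, `σ_a`, `σ_p` become unions. Hence the hypotheses on `S`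
and `T` alone give `π₀₀ᵃ(S ⊕ T) = σ(S ⊕ T) \ (σ_uw(S) ∪ σ_uw(T))`; the two inclusions are
`mem_piA00_prodMap` and `notMem_union_of_mem_piA00_prodMap`. Property `(z)` for the sum thus says
that `σ_uw(S ⊕ T)` and the union have the same complement in `σ(S ⊕ T)`. Both lie in that spectrum,
so they must be equal. -/

theorem prodMap_sub_smul_one (S : X →L[ℂ] X) (T : Y →L[ℂ] Y) (z : ℂ) :
    S.prodMap T - z • (1 : X × Y →L[ℂ] X × Y) =
      (S - z • (1 : X →L[ℂ] X)).prodMap (T - z • (1 : Y →L[ℂ] Y)) := by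
  ext x <;> simp

theorem ker_prodMap (A : X →L[ℂ] X) (B : Y →L[ℂ] Y) :
    LinearMap.ker ((A.prodMap B : X × Y →L[ℂ] X × Y) : X × Y →ₗ[ℂ] X × Y) =
      (LinearMap.ker (A : X →ₗ[ℂ] X)).prod (LinearMap.ker (B : Y →ₗ[ℂ] Y)) := by
  ext ⟨x, y⟩
  simp

theorem nullity_prodMap (A : X →L[ℂ] X) (B : Y →L[ℂ] Y) :
    nullity (A.prodMap B) = nullity A + nullity B := by
  let p := LinearMap.ker (A : X →ₗ[ℂ] X)
  let q := LinearMap.ker (B : Y →ₗ[ℂ] Y)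
  let e : p.prod q ≃ₗ[ℂ] p × q :=
    { toFun x := (⟨x.1.1, x.2.1⟩, ⟨x.1.2, x.2.2⟩)
      invFun x := ⟨(x.1, x.2), x.1.2, x.2.2⟩
      map_add' _ _ := rfl
      map_smul' _ _ := rfl }
  unfold nullity
  rw [ker_prodMap, e.rank_eq, rank_prod, map_add, Cardinal.toENat_lift, Cardinal.toENat_lift]

/-- The quotient by the range of the sum maps onto the product of the quotients. This one inequality
suffices, since the Weyl condition only bounds `β` from below. -/
theorem deficiency_add_le_prodMap (A : X →L[ℂ] X) (B : Y →L[ℂ] Y) :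
    deficiency A + deficiency B ≤ deficiency (A.prodMap B) := by
  set p := LinearMap.range (A : X →ₗ[ℂ] X)
  set q := LinearMap.range (B : Y →ₗ[ℂ] Y)
  set r := LinearMap.range ((A.prodMap B : X × Y →L[ℂ] X × Y) : X × Y →ₗ[ℂ] X × Y)
  have hr : r ≤ LinearMap.ker (p.mkQ.prodMap q.mkQ) := by
    rintro _ ⟨⟨x, y⟩, rfl⟩
    simp [p, q]
  have hsurj : Function.Surjective (r.liftQ (p.mkQ.prodMap q.mkQ) hr) := by
    rintro ⟨a, b⟩
    obtain ⟨x, rfl⟩ := p.mkQ_surjective a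
    obtain ⟨y, rfl⟩ := q.mkQ_surjective b
    exact ⟨r.mkQ (x, y), by simp⟩
  have h := OrderHomClass.mono Cardinal.toENat (LinearMap.rank_le_of_surjective _ hsurj)
  rw [rank_prod, map_add, Cardinal.toENat_lift, Cardinal.toENat_lift] at h
  exact h

theorem isUpperSemiWeyl_iff (A : X →L[ℂ] X) :
    IsUpperSemiWeyl A ↔
      IsClosed (Set.range A) ∧ nullity A < ⊤ ∧ nullity A ≤ deficiency A := by
  unfold IsUpperSemiWeyl IsUpperSemiFredholm
  rw [and_assoc]
  refine and_congr_right fun _ => and_congr_right fun h => ?_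
  unfold index
  rw [EReal.sub_nonpos]
  simp

theorem IsUpperSemiWeyl.prodMap {A : X →L[ℂ] X} {B : Y →L[ℂ] Y}
    (hA : IsUpperSemiWeyl A) (hB : IsUpperSemiWeyl B) : IsUpperSemiWeyl (A.prodMap B) := by
  rw [isUpperSemiWeyl_iff] at *
  refine ⟨?_, ?_, ?_⟩
  · rw [ContinuousLinearMap.coe_prodMap', Set.range_prodMap]
    exact hA.1.prod hB.1
  · rw [nullity_prodMap]
    exact WithTop.add_lt_top.2 ⟨hA.2.1, hB.2.1⟩
  · rw [nullity_prodMap]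
    exact (add_le_add hA.2.2 hB.2.2).trans (deficiency_add_le_prodMap A B)

theorem IsBoundedBelow.injective {A : X →L[ℂ] X} (hA : IsBoundedBelow A) :
    Function.Injective A := by
  obtain ⟨c, hc, h⟩ := hA
  refine (injective_iff_map_eq_zero A).2 fun x hx => ?_
  have := h x
  rw [hx, norm_zero] at this
  exact norm_le_zero_iff.1 (nonpos_of_mul_nonpos_right this hc)

theorem IsBoundedBelow.prodMap {A : X →L[ℂ] X} {B : Y →L[ℂ] Y}
    (hA : IsBoundedBelow A) (hB : IsBoundedBelow B) : IsBoundedBelow (A.prodMap B) := by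
  obtain ⟨c, hc, h⟩ := hA
  obtain ⟨d, hd, k⟩ := hB
  refine ⟨min c d, lt_min hc hd, fun ⟨x, y⟩ => ?_⟩
  simp only [ContinuousLinearMap.coe_prodMap', Prod.map_apply, Prod.norm_mk]
  rw [mul_max_of_nonneg _ _ (lt_min hc hd).le]
  refine max_le_max ?_ ?_
  · exact (mul_le_mul_of_nonneg_right (min_le_left _ _) (norm_nonneg _)).trans (h x)
  · exact (mul_le_mul_of_nonneg_right (min_le_right _ _) (norm_nonneg _)).trans (k y)

theorem isBoundedBelow_prodMap_iff {A : X →L[ℂ] X} {B : Y →L[ℂ] Y} :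
    IsBoundedBelow (A.prodMap B) ↔ IsBoundedBelow A ∧ IsBoundedBelow B := by
  refine ⟨fun ⟨c, hc, h⟩ => ⟨⟨c, hc, fun x => ?_⟩, ⟨c, hc, fun y => ?_⟩⟩, fun h => h.1.prodMap h.2⟩
  · simpa using h (x, 0)
  · simpa using h (0, y)

theorem approxSpectrum_prodMap (S : X →L[ℂ] X) (T : Y →L[ℂ] Y) :
    approxSpectrum (S.prodMap T) = approxSpectrum S ∪ approxSpectrum T := by
  ext z
  simp only [approxSpectrum, Set.mem_ofPred_eq, Set.mem_union, prodMap_sub_smul_one,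
    isBoundedBelow_prodMap_iff, not_and_or]

theorem mem_pointSpectrum_iff {A : X →L[ℂ] X} {z : ℂ} :
    z ∈ pointSpectrum A ↔ ¬ Function.Injective (A - z • (1 : X →L[ℂ] X)) := by
  rw [injective_iff_map_eq_zero]
  simp only [pointSpectrum, Set.mem_ofPred_eq, Module.End.hasEigenvalue_iff, Submodule.ne_bot_iff,
    Module.End.mem_eigenspace_iff]
  simp [sub_eq_zero]

theorem pointSpectrum_prodMap (S : X →L[ℂ] X) (T : Y →L[ℂ] Y) :
    pointSpectrum (S.prodMap T) = pointSpectrum S ∪ pointSpectrum T := by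
  ext z
  simp only [Set.mem_union, mem_pointSpectrum_iff, prodMap_sub_smul_one,
    ContinuousLinearMap.coe_prodMap', Prod.map_injective, not_and_or]

theorem nullity_eq_zero_of_injective {A : X →L[ℂ] X} (hA : Function.Injective A) :
    nullity A = 0 := by
  have h : LinearMap.ker (A : X →ₗ[ℂ] X) = ⊥ := LinearMap.ker_eq_bot.2 hA
  simp [nullity, h]

/-- The reverse inclusion can fail: a positive index of one summand may be offset by a negative
index of the other. -/
theorem upperSemiWeylSpectrum_prodMap_subset (S : X →L[ℂ] X) (T : Y →L[ℂ] Y) :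
    upperSemiWeylSpectrum (S.prodMap T) ⊆ upperSemiWeylSpectrum S ∪ upperSemiWeylSpectrum T := by
  intro z hz
  by_contra! h
  simp only [Set.mem_union, not_or, upperSemiWeylSpectrum, Set.mem_ofPred_eq, not_not] at h
  exact hz (prodMap_sub_smul_one S T z ▸ h.1.prodMap h.2)

variable [CompleteSpace X] [CompleteSpace Y]

theorem IsBoundedBelow.isUpperSemiWeyl {A : X →L[ℂ] X} (hA : IsBoundedBelow A) :
    IsUpperSemiWeyl A := by
  have h0 := nullity_eq_zero_of_injective hA.injective
  refine (isUpperSemiWeyl_iff A).2 ⟨?_, by simp [h0], by simp [h0]⟩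
  obtain ⟨c, hc, h⟩ := hA
  have : AntilipschitzWith ⟨c⁻¹, by positivity⟩ A :=
    A.antilipschitz_of_bound fun x => by
      change ‖x‖ ≤ c⁻¹ * ‖A x‖
      rw [inv_mul_eq_div, le_div_iff₀ hc, mul_comm]
      exact h x
  exact this.isClosed_range A.uniformContinuous

theorem mem_spectrum_iff {A : X →L[ℂ] X} {z : ℂ} :
    z ∈ spectrum ℂ A ↔ ¬ Function.Bijective (A - z • (1 : X →L[ℂ] X)) := by
  rw [spectrum.mem_iff, ← IsUnit.neg_iff, neg_sub, Algebra.algebraMap_eq_smul_one,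
    ContinuousLinearMap.isUnit_iff_bijective]

theorem spectrum_prodMap (S : X →L[ℂ] X) (T : Y →L[ℂ] Y) :
    spectrum ℂ (S.prodMap T) = spectrum ℂ S ∪ spectrum ℂ T := by
  ext z
  simp only [Set.mem_union, mem_spectrum_iff, prodMap_sub_smul_one,
    ContinuousLinearMap.coe_prodMap', Prod.map_bijective, not_and_or]

theorem pointSpectrum_subset_spectrum (A : X →L[ℂ] X) : pointSpectrum A ⊆ spectrum ℂ A :=
  fun _ hz => mem_spectrum_iff.2 fun h => mem_pointSpectrum_iff.1 hz h.1

theorem approxSpectrum_subset_spectrum (A : X →L[ℂ] X) : approxSpectrum A ⊆ spectrum ℂ A := by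
  refine fun z hz => mem_spectrum_iff.2 fun h => hz ?_
  obtain ⟨u, hu⟩ := ContinuousLinearMap.isUnit_iff_bijective.2 h
  rw [← hu]
  refine ⟨(‖(↑u⁻¹ : X →L[ℂ] X)‖ + 1)⁻¹, by positivity, fun x => ?_⟩
  rw [inv_mul_le_iff₀ (by positivity)]
  calc ‖x‖ = ‖(↑u⁻¹ : X →L[ℂ] X) ((u : X →L[ℂ] X) x)‖ := by
        rw [← mul_apply_eq_comp, Units.inv_mul, one_apply_eq_self]
    _ ≤ ‖(↑u⁻¹ : X →L[ℂ] X)‖ * ‖(u : X →L[ℂ] X) x‖ := ContinuousLinearMap.le_opNorm _ _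
    _ ≤ _ := by gcongr; linarith

theorem upperSemiWeylSpectrum_subset_approxSpectrum (A : X →L[ℂ] X) :
    upperSemiWeylSpectrum A ⊆ approxSpectrum A :=
  fun _ hz h => hz h.isUpperSemiWeyl

/-- Points outside `σ(A)` are included because a spectral point of the sum may be regular for one
summand; there closedness of `σ(A)` keeps `σ_a(A)` away. -/
theorem notMem_derivedSet_approxSpectrum {A : X →L[ℂ] X} (hA : HasPropertyZ A) {z : ℂ}
    (hz : z ∉ upperSemiWeylSpectrum A) : z ∉ derivedSet (approxSpectrum A) := by
  by_cases h : z ∈ spectrum ℂ A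
  · exact (hA.subset ⟨h, hz⟩).1.2
  · exact fun hd => h <| (spectrum.isClosed A).closure_subset_iff.2
      (approxSpectrum_subset_spectrum A) (derivedSet_subset_closure _ hd)

/-- An eigenvalue of the sum need be one for only one summand. For the other, a-isoloidness makes an
isolated point of `σ_a` an eigenvalue, so property `(z)` applies. -/
theorem notMem_upperSemiWeylSpectrum {A : X →L[ℂ] X} (hA : HasPropertyZ A) (hiso : IsAIsoloid A)
    {z : ℂ} (hd : z ∉ derivedSet (approxSpectrum A))
    (hfin : nullity (A - z • (1 : X →L[ℂ] X)) < ⊤) : z ∉ upperSemiWeylSpectrum A := by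
  intro h
  have hz : z ∈ iso (approxSpectrum A) := ⟨upperSemiWeylSpectrum_subset_approxSpectrum A h, hd⟩
  exact (hA.superset ⟨hz, hiso hz, hfin⟩).2 h

theorem notMem_union_of_mem_piA00_prodMap {S : X →L[ℂ] X} {T : Y →L[ℂ] Y}
    (hS : HasPropertyZ S) (hT : HasPropertyZ T) (hSiso : IsAIsoloid S) (hTiso : IsAIsoloid T)
    {z : ℂ} (hz : z ∈ piA00 (S.prodMap T)) :
    z ∉ upperSemiWeylSpectrum S ∪ upperSemiWeylSpectrum T := by
  obtain ⟨⟨-, hd⟩, -, hfin⟩ := hz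
  rw [prodMap_sub_smul_one, nullity_prodMap] at hfin
  obtain ⟨hf, hg⟩ := WithTop.add_lt_top.1 hfin
  rw [approxSpectrum_prodMap] at hd
  rintro (h | h)
  · exact notMem_upperSemiWeylSpectrum hS hSiso
      (fun h' => hd (derivedSet_mono _ _ Set.subset_union_left h')) hf h
  · exact notMem_upperSemiWeylSpectrum hT hTiso
      (fun h' => hd (derivedSet_mono _ _ Set.subset_union_right h')) hg h

theorem mem_piA00_prodMap {S : X →L[ℂ] X} {T : Y →L[ℂ] Y}
    (hS : HasPropertyZ S) (hT : HasPropertyZ T) {z : ℂ}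
    (hz : z ∈ spectrum ℂ S ∪ spectrum ℂ T)
    (hzS : z ∉ upperSemiWeylSpectrum S) (hzT : z ∉ upperSemiWeylSpectrum T) :
    z ∈ piA00 (S.prodMap T) := by
  refine ⟨⟨?_, ?_⟩, ?_, ?_⟩
  · rw [approxSpectrum_prodMap]
    exact hz.imp (fun h => (hS.subset ⟨h, hzS⟩).1.1) (fun h => (hT.subset ⟨h, hzT⟩).1.1)
  · rw [approxSpectrum_prodMap, derivedSet_union]
    rintro (h | h)
    · exact notMem_derivedSet_approxSpectrum hS hzS h
    · exact notMem_derivedSet_approxSpectrum hT hzT h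
  · rw [pointSpectrum_prodMap]
    exact hz.imp (fun h => (hS.subset ⟨h, hzS⟩).2.1) (fun h => (hT.subset ⟨h, hzT⟩).2.1)
  · rw [prodMap_sub_smul_one, nullity_prodMap]
    exact WithTop.add_lt_top.2 ⟨(not_not.1 hzS).1.2, (not_not.1 hzT).1.2⟩

end DirectSum

end PropertyZ

theorem theorem3p11
    {X : Type*} [NormedAddCommGroup X] [NormedSpace ℂ X] [CompleteSpace X]
    {Y : Type*} [NormedAddCommGroup Y] [NormedSpace ℂ Y] [CompleteSpace Y]
    (S : X →L[ℂ] X) (T : Y →L[ℂ] Y)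
    (hS : PropertyZ.HasPropertyZ S) (hT : PropertyZ.HasPropertyZ T)
    (hSiso : PropertyZ.IsAIsoloid S) (hTiso : PropertyZ.IsAIsoloid T) :
    PropertyZ.HasPropertyZ (S.prodMap T) ↔
      PropertyZ.upperSemiWeylSpectrum (S.prodMap T) =
        PropertyZ.upperSemiWeylSpectrum S ∪ PropertyZ.upperSemiWeylSpectrum T := by
  constructor
  · intro h
    refine (PropertyZ.upperSemiWeylSpectrum_prodMap_subset S T).antisymm fun z hz => ?_
    by_contra hn
    -- With `hn`, this lets property `(z)` of the sum put `z` in `π₀₀ᵃ(S ⊕ T)`, which misses the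
    -- union.
    have hσ : z ∈ spectrum ℂ (S.prodMap T) := by
      rw [PropertyZ.spectrum_prodMap]
      exact hz.imp
        (fun h => PropertyZ.approxSpectrum_subset_spectrum S
          (PropertyZ.upperSemiWeylSpectrum_subset_approxSpectrum S h))
        (fun h => PropertyZ.approxSpectrum_subset_spectrum T
          (PropertyZ.upperSemiWeylSpectrum_subset_approxSpectrum T h))
    exact PropertyZ.notMem_union_of_mem_piA00_prodMap hS hT hSiso hTiso (h.subset ⟨hσ, hn⟩) hz
  · intro h
    refine Set.Subset.antisymm ?_ fun z hz => ⟨?_, ?_⟩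
    · rintro z ⟨hσ, hn⟩
      rw [h, Set.mem_union, not_or] at hn
      rw [PropertyZ.spectrum_prodMap] at hσ
      exact PropertyZ.mem_piA00_prodMap hS hT hσ hn.1 hn.2
    · exact PropertyZ.pointSpectrum_subset_spectrum _ hz.2.1
    · rw [h]
      exact PropertyZ.notMem_union_of_mem_piA00_prodMap hS hT hSiso hTiso hz
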